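/- Let $(\Omega,\mathcal H,\hat{\mathbb E})$ be a sublinear expectation space: $\mathcal H$ is a linear space of real functions on $\Omega$ with $\varphi(X_1,\dots,X_n)\in\mathcal H$ for all $X_1,\dots,X_n\in\mathcal H$ and all Lipschitz $\varphi:\mathbb R^n\to\mathbb R$, and $\hat{\mathbb E}:\mathcal H\to\mathbb R$ is monotone, constant preserving, sub-additive and positively homogeneous. Write $X\overset{d}{=}Y$ (where $X$, $Y$ may live on different sublinear expectation spaces) if $\varphi(X)$ and $\varphi(Y)$ have the same sublinear expectation for every Lipschitz $\varphi:\mathbb R\to\mathbb R$. Say that $\bar X$ is an independent copy of $X$ if both are random variables on the same space, $\bar X\overset{d}{=}X$, and $\hat{\mathbb E}[\varphi(X,\bar X)]=\hat{\mathbb E}\big[\hat{\mathbb E}[\varphi(x,\bar X)]_{x=X}\big]$ for every Lipschitz $\varphi:\mathbb R^2\to\mathbb R$. Say that $X$ is maximally distributed if there is a bounded, closed, convex set $\Lambda\subset\mathbb R$ with $\hat{\mathbb E}[\varphi(X)]=\max_{x\in\Lambda}\varphi(x)$ for every Lipschitz $\varphi:\mathbb R\to\mathbb R$. **Proposition.**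 Let $X\in\mathcal H$ be uniformly integrable, i.e. $\lim_{\lambda\to\infty}\hat{\mathbb E}[(|X|-\lambda)^+]=0$. Then $X$ is maximally distributed if and only if $$aX+b\bar X\overset{d}{=}(a+b)X\qquad\text{for all } a,b\ge 0,$$ where $\bar X$ is an independent copy of $X$. Here the pair $(X,\bar X)$ may be realised on any sublinear expectation space: the equivalence holds for every pair $(Y,\bar Y)$ such that $Y\overset{d}{=}X$ and $\bar Y$ is an independent copy of $Y$, with $aY+b\bar Y$ in place of $aX+b\bar X$ (in particular for $Y=X$ and any independent copy $\bar X\in\mathcal H$ of $X$). Such a pair always exists: there is a sublinear expectation on some space of functions on $\Omega\times\Omega$ for which $(\omega_1,\omega_2)\mapsto X(\omega_1)$ is distributed as $X$ and $(\omega_1,\omega_2)\mapsto X(\omega_2)$ is an independent copy of it. -/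

import Mathlib

open scoped NNReal Topology

/-- Membership in `C_Lip`: the function is Lipschitz for some constant. On `Fin n → ℝ` and on
`ℝ × ℝ` Mathlib uses the sup metric, which has the same Lipschitz functions as the Euclidean one. -/
def IsLip {α : Type*} [PseudoEMetricSpace α] (φ : α → ℝ) : Prop :=
  ∃ K : ℝ≥0, LipschitzWith K φ

/-- A sublinear expectation space `(Ω, H, E)`. The functional `E` is written as a total function,
but it is constrained (and used below) on the space `H` of random variables only. -/
structure SublinearExpectationSpace (Ω : Type*) where
  /-- The linear space of random variables. -/
  H : Submodule ℝ (Ω → ℝ)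
  /-- Lipschitz functions of finitely many random variables are random variables. -/
  lip_comp_mem : ∀ (n : ℕ) (X : Fin n → Ω → ℝ), (∀ i, X i ∈ H) →
    ∀ φ : (Fin n → ℝ) → ℝ, IsLip φ → (fun ω => φ (fun i => X i ω)) ∈ H
  /-- The sublinear expectation. -/
  E : (Ω → ℝ) → ℝ
  mono : ∀ X ∈ H, ∀ Y ∈ H, (∀ ω, Y ω ≤ X ω) → E Y ≤ E X
  const : ∀ c : ℝ, E (fun _ => c) = c
  subadd : ∀ X ∈ H, ∀ Y ∈ H, E (fun ω => X ω + Y ω) ≤ E X + E Y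
  pos_homog : ∀ X ∈ H, ∀ l : ℝ, 0 ≤ l → E (fun ω => l * X ω) = l * E X

namespace SublinearExpectationSpace

variable {Ω Ω' : Type*}

/-- `X` is uniformly integrable: `E[(|X| - c)⁺] → 0` as `c → ∞`. -/
def UniformlyIntegrable (S : SublinearExpectationSpace Ω) (X : Ω → ℝ) : Prop :=
  Filter.Tendsto (fun c : ℝ => S.E (fun ω => max (|X ω| - c) 0)) Filter.atTop (𝓝 0)

/-- `X` on the space `S` and `Y` on the space `S'` are identically distributed. -/
def IdentDistrib (S : SublinearExpectationSpace Ω) (X : Ω → ℝ)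
    (S' : SublinearExpectationSpace Ω') (Y : Ω' → ℝ) : Prop :=
  ∀ φ : ℝ → ℝ, IsLip φ → S.E (fun ω => φ (X ω)) = S'.E (fun ω => φ (Y ω))

/-- `S.IndepOf Y X`: the random variable `Y` is independent of the random variable `X`, that is
`E[φ(X, Y)] = E[E[φ(x, Y)]_{x = X}]` for all Lipschitz `φ`. This relation is not symmetric. -/
def IndepOf (S : SublinearExpectationSpace Ω) (Y X : Ω → ℝ) : Prop :=
  ∀ φ : ℝ × ℝ → ℝ, IsLip φ →
    S.E (fun ω => φ (X ω, Y ω)) = S.E (fun ω => (fun x : ℝ => S.E (fun ω' => φ (x, Y ω'))) (X ω))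

/-- `S.IsIndepCopy Y X`: the random variable `Y` is an independent copy of `X`. -/
structure IsIndepCopy (S : SublinearExpectationSpace Ω) (Y X : Ω → ℝ) : Prop where
  mem : Y ∈ S.H
  indep : S.IndepOf Y X
  ident : S.IdentDistrib Y S X

/-- `X` is maximally distributed: for some bounded, closed, convex `Λ ⊆ ℝ`, the number `E[φ(X)]`
is the maximum of `φ` over `Λ`, for all Lipschitz `φ`. -/
def MaximallyDistributed (S : SublinearExpectationSpace Ω) (X : Ω → ℝ) : Prop :=
  ∃ Λ : Set ℝ, Bornology.IsBounded Λ ∧ IsClosed Λ ∧ Convex ℝ Λ ∧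
    ∀ φ : ℝ → ℝ, IsLip φ → IsGreatest (φ '' Λ) (S.E (fun ω => φ (X ω)))

/-! The expectations above are taken of members of `H` only. -/

theorem comp_mem (S : SublinearExpectationSpace Ω) {X : Ω → ℝ} (hX : X ∈ S.H)
    {φ : ℝ → ℝ} (hφ : IsLip φ) : (fun ω => φ (X ω)) ∈ S.H := by
  obtain ⟨K, hK⟩ := hφ
  exact S.lip_comp_mem 1 (fun _ => X) (fun _ => hX) (fun v => φ (v 0))
    ⟨K * 1, hK.comp (LipschitzWith.eval 0)⟩

theorem comp₂_mem (S : SublinearExpectationSpace Ω) {X Y : Ω → ℝ} (hX : X ∈ S.H) (hY : Y ∈ S.H)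
    {φ : ℝ × ℝ → ℝ} (hφ : IsLip φ) : (fun ω => φ (X ω, Y ω)) ∈ S.H := by
  obtain ⟨K, hK⟩ := hφ
  refine S.lip_comp_mem 2 ![X, Y] (fun i => by fin_cases i <;> simpa)
    (fun v => φ (v 0, v 1)) ⟨K * max 1 1, hK.comp ?_⟩
  exact (LipschitzWith.eval (α := fun _ : Fin 2 => ℝ) 0).prodMk (LipschitzWith.eval 1)

theorem const_mem (S : SublinearExpectationSpace Ω) (c : ℝ) : (fun _ : Ω => c) ∈ S.H :=
  S.lip_comp_mem 0 (fun _ _ => 0) (fun i => i.elim0) (fun _ => c) ⟨0, LipschitzWith.const c⟩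

theorem isLip_inner (S : SublinearExpectationSpace Ω) {Y : Ω → ℝ} (hY : Y ∈ S.H)
    {φ : ℝ × ℝ → ℝ} (hφ : IsLip φ) : IsLip (fun x : ℝ => S.E (fun ω => φ (x, Y ω))) := by
  obtain ⟨K, hK⟩ := hφ
  have hm : ∀ x : ℝ, (fun ω => φ (x, Y ω)) ∈ S.H := fun x =>
    S.comp₂_mem (S.const_mem x) hY ⟨K, hK⟩
  refine ⟨K, LipschitzWith.of_le_add_mul K fun x y => ?_⟩
  have h1 : S.E (fun ω => φ (x, Y ω)) ≤ S.E (fun ω => φ (y, Y ω) + K * dist x y) := by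
    refine S.mono _ (S.H.add_mem (hm y) (S.const_mem _)) _ (hm x) fun ω => ?_
    change φ (x, Y ω) ≤ φ (y, Y ω) + K * dist x y
    have h := hK.dist_le_mul (x, Y ω) (y, Y ω)
    rw [Real.dist_eq] at h
    have h2 : dist (x, Y ω) (y, Y ω) = dist x y := by simp [Prod.dist_eq]
    rw [h2] at h
    have := le_abs_self (φ (x, Y ω) - φ (y, Y ω))
    linarith
  have h3 := S.subadd _ (hm y) _ (S.const_mem (K * dist x y))
  rw [S.const] at h3
  exact h1.trans h3

theorem inner_mem (S : SublinearExpectationSpace Ω) {X Y : Ω → ℝ} (hX : X ∈ S.H) (hY : Y ∈ S.H)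
    {φ : ℝ × ℝ → ℝ} (hφ : IsLip φ) :
    (fun ω => (fun x : ℝ => S.E (fun ω' => φ (x, Y ω'))) (X ω)) ∈ S.H :=
  S.comp_mem hX (S.isLip_inner hY hφ)

end SublinearExpectationSpace

/-! An independent copy enters only through iterated expectations, so the condition on `a`, `b` is
`IsAdditive`, a property of the law of `X` alone. If `X` is maximal on `Λ`, the iterated expectation
maximises over `Λ × Λ`, and convexity gives `aΛ + bΛ = (a + b)Λ`. The converse is a law of large
numbers. Additivity makes `X` distributed as the mean of `n` successive independent copies. For a
smooth test function, each step of size `1 / n` contributes its first-order term, computed by `E`,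
and an error `o(1 / n)`; uniform integrability replaces a second moment here. Summing `n` steps,
with `p = E[X]` and `q = E[-X]`, shows that `X` does not leave `[-q, p]` (`E_pos_part_le_zero`, for
`X` and `-X`) and that each `v` in `[-q, p]` is attained (`E_neg_abs_sub_nonneg`). Lipschitz
comparison then gives the maximum formula with `Λ = [-q, p]`. -/

namespace IsLip

theorem comp {α β : Type*} [PseudoEMetricSpace α] [PseudoEMetricSpace β] {φ : β → ℝ}
    (hφ : IsLip φ) {f : α → β} {K : ℝ≥0} (hf : LipschitzWith K f) : IsLip (fun x => φ (f x)) := by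
  obtain ⟨L, hL⟩ := hφ
  exact ⟨L * K, hL.comp hf⟩

theorem comp_isLip {α : Type*} [PseudoEMetricSpace α] {φ : ℝ → ℝ} {f : α → ℝ} (hφ : IsLip φ)
    (hf : IsLip f) : IsLip (fun x => φ (f x)) :=
  hφ.comp hf.choose_spec

theorem add {α : Type*} [PseudoEMetricSpace α] {φ ψ : α → ℝ} (hφ : IsLip φ) (hψ : IsLip ψ) :
    IsLip (fun x => φ x + ψ x) := by
  obtain ⟨K, hK⟩ := hφ
  obtain ⟨L, hL⟩ := hψ
  exact ⟨K + L, hK.add hL⟩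

theorem const_mul {α : Type*} [PseudoMetricSpace α] {φ : α → ℝ} (hφ : IsLip φ) (c : ℝ) :
    IsLip (fun x => c * φ x) := by
  obtain ⟨K, hK⟩ := hφ
  refine ⟨‖c‖₊ * K, LipschitzWith.of_dist_le_mul fun x y => ?_⟩
  have := hK.dist_le_mul x y
  rw [Real.dist_eq] at this ⊢
  rw [← mul_sub, abs_mul, NNReal.coe_mul, coe_nnnorm, Real.norm_eq_abs, mul_assoc]
  gcongr

theorem const {α : Type*} [PseudoEMetricSpace α] (c : ℝ) : IsLip (fun _ : α => c) :=
  ⟨0, LipschitzWith.const c⟩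

theorem id : IsLip (fun x : ℝ => x) := ⟨1, LipschitzWith.id⟩

theorem fst : IsLip (fun p : ℝ × ℝ => p.1) := ⟨1, LipschitzWith.prod_fst⟩

theorem snd : IsLip (fun p : ℝ × ℝ => p.2) := ⟨1, LipschitzWith.prod_snd⟩

theorem max {α : Type*} [PseudoEMetricSpace α] {φ ψ : α → ℝ} (hφ : IsLip φ) (hψ : IsLip ψ) :
    IsLip (fun x => Max.max (φ x) (ψ x)) := by
  obtain ⟨K, hK⟩ := hφ
  obtain ⟨L, hL⟩ := hψ
  exact ⟨_, hK.max hL⟩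

theorem abs {α : Type*} [PseudoMetricSpace α] {φ : α → ℝ} (hφ : IsLip φ) :
    IsLip (fun x => |φ x|) := by
  simpa [abs_eq_max_neg] using hφ.max (hφ.const_mul (-1))

theorem affine (c d : ℝ) : IsLip (fun x : ℝ => c + d * x) :=
  (IsLip.const c).add (IsLip.id.const_mul d)

end IsLip

/-! ### Tangent-line estimates for a smoothed absolute value -/

/-- A smooth Lipschitz approximation of the absolute value. -/
noncomputable def smoothAbs (ε x : ℝ) : ℝ := √(x ^ 2 + ε ^ 2)

section smoothAbs

variable {ε : ℝ}

theorem sq_smoothAbs (ε x : ℝ) : smoothAbs ε x ^ 2 = x ^ 2 + ε ^ 2 :=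
  Real.sq_sqrt (by positivity)

theorem smoothAbs_pos (hε : 0 < ε) (x : ℝ) : 0 < smoothAbs ε x :=
  Real.sqrt_pos.2 (by positivity)

theorem abs_le_smoothAbs (ε x : ℝ) : |x| ≤ smoothAbs ε x :=
  Real.abs_le_sqrt (by nlinarith [sq_nonneg ε])

theorem le_smoothAbs (ε x : ℝ) : ε ≤ smoothAbs ε x :=
  Real.le_sqrt_of_sq_le (by nlinarith [sq_nonneg x])

theorem smoothAbs_zero (hε : 0 < ε) : smoothAbs ε 0 = ε := by
  simp [smoothAbs, Real.sqrt_sq hε.le]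

theorem smoothAbs_add_le_abs (hε : 0 < ε) (x y : ℝ) :
    smoothAbs ε (x + y) ≤ smoothAbs ε x + |y| := by
  have h0 := smoothAbs_pos hε x
  refine Real.sqrt_le_iff.2 ⟨by positivity, ?_⟩
  have h1 : x * y ≤ smoothAbs ε x * |y| := by
    calc x * y ≤ |x * y| := le_abs_self _
      _ = |x| * |y| := abs_mul _ _
      _ ≤ _ := by gcongr; exact abs_le_smoothAbs ε x
  nlinarith [sq_smoothAbs ε x, sq_abs y]

theorem isLip_smoothAbs (hε : 0 < ε) : IsLip (smoothAbs ε) := by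
  refine ⟨1, LipschitzWith.of_le_add fun x y => ?_⟩
  simpa [Real.dist_eq] using smoothAbs_add_le_abs hε y (x - y)

theorem abs_div_smoothAbs_le_one (hε : 0 < ε) (x : ℝ) : |x / smoothAbs ε x| ≤ 1 := by
  have h0 := smoothAbs_pos hε x
  rw [abs_div, abs_of_pos h0, div_le_one h0]
  exact abs_le_smoothAbs ε x

/-- Convexity; after squaring, it reduces to the slope being at most 1 in absolute value. -/
theorem smoothAbs_tangent_le (hε : 0 < ε) (x y : ℝ) :
    smoothAbs ε x + x / smoothAbs ε x * y ≤ smoothAbs ε (x + y) := by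
  have h0 := smoothAbs_pos hε x
  have h2 := sq_smoothAbs ε x
  refine Real.le_sqrt_of_sq_le ?_
  have h3 : (smoothAbs ε x + x / smoothAbs ε x * y) ^ 2
      = smoothAbs ε x ^ 2 + 2 * x * y + (x / smoothAbs ε x) ^ 2 * y ^ 2 := by
    field_simp
    ring
  have h4 : (x / smoothAbs ε x) ^ 2 ≤ 1 :=
    (sq_le_one_iff_abs_le_one _).2 (abs_div_smoothAbs_le_one hε x)
  nlinarith [mul_le_mul_of_nonneg_right h4 (sq_nonneg y)]

theorem smoothAbs_le_tangent_add_sq (hε : 0 < ε) (x y : ℝ) :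
    smoothAbs ε (x + y) ≤ smoothAbs ε x + x / smoothAbs ε x * y + y ^ 2 / (2 * ε) := by
  have h0 := smoothAbs_pos hε x
  have h2 := sq_smoothAbs ε x
  have h3 := sq_smoothAbs ε (x + y)
  have h4 : y ^ 2 / (2 * smoothAbs ε x) ≤ y ^ 2 / (2 * ε) := by
    gcongr
    exact le_smoothAbs ε x
  have h5 : smoothAbs ε (x + y)
      ≤ smoothAbs ε x + x / smoothAbs ε x * y + y ^ 2 / (2 * smoothAbs ε x) := by
    rw [show smoothAbs ε x + x / smoothAbs ε x * y + y ^ 2 / (2 * smoothAbs ε x)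
      = (2 * smoothAbs ε x ^ 2 + 2 * x * y + y ^ 2) / (2 * smoothAbs ε x) by field_simp]
    rw [le_div_iff₀ (by positivity)]
    nlinarith [sq_nonneg (smoothAbs ε (x + y) - smoothAbs ε x)]
  linarith

/-- The quadratic Taylor error may have no useful expectation, so it is kept only for `|y| ≤ 2 * l`;
the tail is linear in `y` and is controlled by uniform integrability. -/
theorem smoothAbs_le_tangent_add (hε : 0 < ε) {t : ℝ} (ht : 0 ≤ t) (l x y : ℝ) :
    smoothAbs ε (x + t * y) ≤ smoothAbs ε x + x / smoothAbs ε x * (t * y)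
      + (2 * t ^ 2 * l ^ 2 / ε + 4 * t * max (|y| - l) 0) := by
  rcases le_total |y| (2 * l) with h | h
  · have h1 := smoothAbs_le_tangent_add_sq hε x (t * y)
    have h2 : y ^ 2 ≤ (2 * l) ^ 2 := sq_le_sq' (by linarith [neg_abs_le y])
      (by linarith [le_abs_self y])
    have h3 : (t * y) ^ 2 / (2 * ε) ≤ 2 * t ^ 2 * l ^ 2 / ε := by
      rw [mul_pow]
      calc t ^ 2 * y ^ 2 / (2 * ε) ≤ t ^ 2 * (2 * l) ^ 2 / (2 * ε) := by gcongr
        _ = _ := by field_simp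
    have h4 : 0 ≤ 4 * t * max (|y| - l) 0 := by positivity
    linarith
  -- Function and tangent each move by at most `t * |y|`, and here `|y| ≤ 2 * (|y| - l)`, whence the
  -- factor 4.
  · have h1 := smoothAbs_add_le_abs hε x (t * y)
    have h2 := abs_div_smoothAbs_le_one hε x
    have h3 : -(x / smoothAbs ε x * (t * y)) ≤ |t * y| := by
      calc -(x / smoothAbs ε x * (t * y)) ≤ |x / smoothAbs ε x * (t * y)| := neg_le_abs _
        _ = |x / smoothAbs ε x| * |t * y| := abs_mul _ _
        _ ≤ 1 * |t * y| := by gcongr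
        _ = _ := one_mul _
    have h4 : |t * y| = t * |y| := by rw [abs_mul, abs_of_nonneg ht]
    have h5 : t * |y| ≤ t * (2 * max (|y| - l) 0) := by
      gcongr
      linarith [le_max_left (|y| - l) 0]
    have h6 : 0 ≤ 2 * t ^ 2 * l ^ 2 / ε := by positivity
    linarith

end smoothAbs

/-! ### Additivity as iterated expectation -/

namespace SublinearExpectationSpace

variable {Ω Ω' : Type*}

theorem E_add_const (S : SublinearExpectationSpace Ω) {Z : Ω → ℝ} (hZ : Z ∈ S.H) (c : ℝ) :
    S.E (fun ω => Z ω + c) = S.E Z + c := by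
  have h1 := S.subadd _ hZ _ (S.const_mem c)
  have h2 := S.subadd _ (S.H.add_mem hZ (S.const_mem c)) _ (S.const_mem (-c))
  rw [S.const] at h1 h2
  simp only [Pi.add_apply, add_neg_cancel_right] at h2
  change S.E Z ≤ S.E (fun ω => Z ω + c) + -c at h2
  linarith

/-- The law of `(a + b) X` is that of `a X + b X'` for an independent copy `X'` of `X`, expressed
by iterated expectations. -/
def IsAdditive (S : SublinearExpectationSpace Ω) (X : Ω → ℝ) : Prop :=
  ∀ φ : ℝ → ℝ, IsLip φ → ∀ a b : ℝ, 0 ≤ a → 0 ≤ b →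
    S.E (fun ω => φ ((a + b) * X ω)) = S.E (fun ω => S.E (fun ω' => φ (a * X ω + b * X ω')))

theorem isLip_inner_affine (S : SublinearExpectationSpace Ω) {X : Ω → ℝ} (hX : X ∈ S.H)
    {φ : ℝ → ℝ} (hφ : IsLip φ) (a b : ℝ) :
    IsLip (fun x : ℝ => S.E (fun ω => φ (a * x + b * X ω))) :=
  S.isLip_inner hX (φ := fun p => φ (a * p.1 + b * p.2))
    (hφ.comp_isLip ((IsLip.fst.const_mul a).add (IsLip.snd.const_mul b)))

/-- The expectation of a Lipschitz function of `a Y + b Ybar`, when `Ybar` is an independent copy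
of `Y` and `Y` is distributed as `X`. -/
theorem IsIndepCopy.E_comp_add {S : SublinearExpectationSpace Ω} {X : Ω → ℝ} (hX : X ∈ S.H)
    {T : SublinearExpectationSpace Ω'} {Y Ybar : Ω' → ℝ}
    (hYX : T.IdentDistrib Y S X) (hc : T.IsIndepCopy Ybar Y) {φ : ℝ → ℝ} (hφ : IsLip φ)
    (a b : ℝ) :
    T.E (fun ω => φ (a * Y ω + b * Ybar ω))
      = S.E (fun ω => S.E (fun ω' => φ (a * X ω + b * X ω'))) := by
  have h1 := hc.indep (fun p => φ (a * p.1 + b * p.2))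
    (hφ.comp_isLip ((IsLip.fst.const_mul a).add (IsLip.snd.const_mul b)))
  have h2 : ∀ x : ℝ, T.E (fun ω => φ (a * x + b * Ybar ω)) = S.E (fun ω => φ (a * x + b * X ω)) := by
    intro x
    have hl : IsLip (fun y => φ (a * x + b * y)) := hφ.comp_isLip (IsLip.affine (a * x) b)
    rw [hc.ident _ hl, hYX _ hl]
  rw [h1]
  simp only [h2]
  exact hYX _ (S.isLip_inner_affine hX hφ a b)

theorem IsAdditive.neg {S : SublinearExpectationSpace Ω} {X : Ω → ℝ} (h : S.IsAdditive X) :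
    S.IsAdditive (fun ω => -X ω) := by
  intro φ hφ a b ha hb
  have := h (fun x => φ (-1 * x)) (hφ.comp_isLip (IsLip.id.const_mul (-1))) a b ha hb
  simpa only [neg_one_mul, mul_neg, neg_add] using this

theorem UniformlyIntegrable.neg {S : SublinearExpectationSpace Ω} {X : Ω → ℝ}
    (h : S.UniformlyIntegrable X) : S.UniformlyIntegrable (fun ω => -X ω) := by
  simpa only [UniformlyIntegrable, abs_neg] using h

variable {S : SublinearExpectationSpace Ω} {X : Ω → ℝ}

/-- A one-step upper bound on `E[f(x + t X)]` for all `x` may be iterated. -/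
theorem IsAdditive.iterate_le (hA : S.IsAdditive X) (hX : X ∈ S.H) {f : ℝ → ℝ} (hf : IsLip f)
    {t w e : ℝ} (ht : 0 ≤ t) (h : ∀ x, S.E (fun ω => f (x + t * X ω)) ≤ f (x + t * w) + e)
    (k : ℕ) (x : ℝ) : S.E (fun ω => f (x + k * t * X ω)) ≤ f (x + k * t * w) + k * e := by
  induction k generalizing x with
  | zero => simp [S.const]
  | succ k ih =>
    have hfx : IsLip (fun y => f (x + y)) := by
      simpa using hf.comp_isLip (IsLip.affine x 1)
    -- The outer variable takes one step of size `t`; the induction hypothesis treats the inner one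
    -- from the random base point `x + t * X ω`.
    have h1 := hA _ hfx t (k * t) ht (by positivity)
    have h2 : S.E (fun ω => S.E (fun ω' => f (x + (t * X ω + k * t * X ω'))))
        ≤ S.E (fun ω => f (x + k * t * w + t * X ω) + k * e) := by
      refine S.mono _ ?_ _ (S.comp_mem hX (S.isLip_inner_affine hX hfx t (k * t))) fun ω => ?_
      · exact S.comp_mem hX ((hf.comp_isLip (IsLip.affine _ t)).add (IsLip.const _))
      · have := ih (x + t * X ω)
        simp only [add_assoc] at this ⊢
        rwa [add_comm (k * t * w) (t * X ω)]
    rw [S.E_add_const (S.comp_mem hX (hf.comp_isLip (IsLip.affine _ t)))] at h2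
    have h3 := h (x + k * t * w)
    push_cast
    rw [show (k + 1 : ℝ) * t = t + k * t by ring, h1,
      show x + (t + k * t) * w = x + k * t * w + t * w by ring]
    linarith

/-- A one-step lower bound on `E[f(x + t X)]` for all `x` may be iterated. -/
theorem IsAdditive.le_iterate (hA : S.IsAdditive X) (hX : X ∈ S.H) {f : ℝ → ℝ} (hf : IsLip f)
    {t w e : ℝ} (ht : 0 ≤ t) (h : ∀ x, f (x + t * w) - e ≤ S.E (fun ω => f (x + t * X ω)))
    (k : ℕ) (x : ℝ) : f (x + k * t * w) - k * e ≤ S.E (fun ω => f (x + k * t * X ω)) := by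
  induction k generalizing x with
  | zero => simp [S.const]
  | succ k ih =>
    have hfx : IsLip (fun y => f (x + y)) := by
      simpa using hf.comp_isLip (IsLip.affine x 1)
    have h1 := hA _ hfx t (k * t) ht (by positivity)
    have h2 : S.E (fun ω => f (x + k * t * w + t * X ω) + -(k * e))
        ≤ S.E (fun ω => S.E (fun ω' => f (x + (t * X ω + k * t * X ω')))) := by
      refine S.mono _ (S.comp_mem hX (S.isLip_inner_affine hX hfx t (k * t))) _ ?_ fun ω => ?_
      · exact S.comp_mem hX ((hf.comp_isLip (IsLip.affine _ t)).add (IsLip.const _))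
      · have := ih (x + t * X ω)
        rw [← sub_eq_add_neg]
        simp only [add_assoc] at this ⊢
        rwa [add_comm (k * t * w) (t * X ω)]
    rw [S.E_add_const (S.comp_mem hX (hf.comp_isLip (IsLip.affine _ t)))] at h2
    have h3 := h (x + k * t * w)
    push_cast
    rw [show (k + 1 : ℝ) * t = t + k * t by ring, h1,
      show x + (t + k * t) * w = x + k * t * w + t * w by ring]
    linarith

theorem isLip_tail (l : ℝ) : IsLip (fun x : ℝ => max (|x| - l) 0) := by
  simpa only [sub_eq_add_neg] using (IsLip.id.abs.add (IsLip.const (-l))).max (IsLip.const 0)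

theorem isLip_remainder (c d l : ℝ) : IsLip (fun x : ℝ => c + d * max (|x| - l) 0) :=
  (IsLip.const c).add ((isLip_tail l).const_mul d)

theorem E_remainder (hX : X ∈ S.H) (c l : ℝ) {d : ℝ} (hd : 0 ≤ d) :
    S.E (fun ω => c + d * max (|X ω| - l) 0) = c + d * S.E (fun ω => max (|X ω| - l) 0) := by
  have h := S.E_add_const (S.comp_mem hX ((isLip_tail l).const_mul d)) c
  rw [S.pos_homog _ (S.comp_mem hX (isLip_tail l)) d hd] at h
  simpa only [add_comm] using h

/-- On multiples of `X`, `E` is the support function of `[-E[-X], E[X]]`. -/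
theorem mul_le_E_mul (hX : X ∈ S.H) {v : ℝ} (hv : -S.E (fun ω => -X ω) ≤ v) (hv' : v ≤ S.E X)
    (c : ℝ) : c * v ≤ S.E (fun ω => c * X ω) := by
  rcases le_total 0 c with hc | hc
  · rw [S.pos_homog X hX c hc]
    gcongr
  · have h := S.pos_homog (fun ω => -X ω) (S.H.neg_mem hX) (-c) (by linarith)
    simp only [neg_mul_neg] at h
    rw [h]
    nlinarith

/-- There is a step size `1 / n` for which `n` times the one-step error is small. -/
theorem UniformlyIntegrable.exists_step (hU : S.UniformlyIntegrable X) {ε η : ℝ} (hε : 0 < ε)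
    (hη : 0 < η) : ∃ n : ℕ, ∃ t l : ℝ, 0 ≤ t ∧ n * t = 1 ∧
      n * (2 * t ^ 2 * l ^ 2 / ε + 4 * t * S.E (fun ω => max (|X ω| - l) 0)) < η := by
  -- The level `l` is fixed first, making the tail cost less than `η / 2`; then `n` makes the
  -- quadratic cost `2 * l ^ 2 / (ε * n)` less than `η / 2`.
  obtain ⟨l, hl⟩ := (hU.eventually_lt_const (show (0 : ℝ) < η / 8 by positivity)).exists
  obtain ⟨n, hn⟩ := exists_nat_gt (4 * l ^ 2 / (ε * η))
  have hn0 : (0 : ℝ) < n := lt_of_le_of_lt (by positivity) hn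
  refine ⟨n, 1 / n, l, by positivity, by field_simp, ?_⟩
  have h1 : (n : ℝ) * (2 * (1 / n) ^ 2 * l ^ 2 / ε
      + 4 * (1 / n) * S.E (fun ω => max (|X ω| - l) 0))
      = 2 * l ^ 2 / ε / n + 4 * S.E (fun ω => max (|X ω| - l) 0) := by
    field_simp
  have h2 : 2 * l ^ 2 / ε / n < η / 2 := by
    rw [div_lt_iff₀ (by positivity)] at hn
    rw [div_div, div_lt_iff₀ (by positivity)]
    nlinarith
  rw [h1]
  linarith

/-! ### The law of large numbers and the maximum formula -/

theorem IsAdditive.E_pos_part_le_zero (hA : S.IsAdditive X) (hX : X ∈ S.H)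
    (hU : S.UniformlyIntegrable X) : S.E (fun ω => max (X ω - S.E X) 0) ≤ 0 := by
  refine le_of_forall_pos_le_add fun δ hδ => ?_
  have hε : 0 < δ / 2 := by positivity
  set ε := δ / 2 with hεdef
  obtain ⟨n, t, l, ht, hnt, hn⟩ := hU.exists_step hε hε
  set U := S.E (fun ω => max (|X ω| - l) 0)
  set m := S.E X
  -- This function dominates the positive part and equals `ε` at 0. Its slope `1 + c` is
  -- nonnegative, so positive homogeneity evaluates the first-order term exactly.
  have hg : IsLip (fun x => x + smoothAbs ε x) := IsLip.id.add (isLip_smoothAbs hε)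
  have hstep : ∀ x, S.E (fun ω => (x + t * X ω) + smoothAbs ε (x + t * X ω))
      ≤ ((x + t * m) + smoothAbs ε (x + t * m)) + (2 * t ^ 2 * l ^ 2 / ε + 4 * t * U) := by
    intro x
    have h3 := smoothAbs_tangent_le hε x (t * m)
    have hr := fun y => smoothAbs_le_tangent_add hε ht l x y
    have hc := abs_div_smoothAbs_le_one hε x
    set c := x / smoothAbs ε x
    have hc1 : 0 ≤ (1 + c) * t := mul_nonneg (by linarith [neg_abs_le c]) ht
    have hmul := S.comp_mem hX (IsLip.id.const_mul ((1 + c) * t))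
    have hrem := S.comp_mem hX
      (isLip_remainder (x + smoothAbs ε x + 2 * t ^ 2 * l ^ 2 / ε) (4 * t) l)
    have h1 := S.mono _ (S.H.add_mem hmul hrem) _
      (S.comp_mem hX (hg.comp_isLip (IsLip.affine x t))) fun ω => by
        have := hr (X ω)
        simp only [Pi.add_apply]
        linarith
    have h2 := S.subadd _ hmul _ hrem
    rw [S.pos_homog X hX _ hc1, E_remainder hX _ _ (by positivity)] at h2
    have h4 := h1.trans h2
    linarith
  have h := hA.iterate_le hX hg ht hstep n (-m)
  simp only [hnt, one_mul, neg_add_cancel, smoothAbs_zero hε] at h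
  have h5 : S.E (fun ω => max (X ω - m) 0) ≤ S.E (fun ω => (-m + X ω) + smoothAbs ε (-m + X ω)) := by
    refine S.mono _ ?_ _ ?_ fun ω => ?_
    · simpa using S.comp_mem hX (hg.comp_isLip (IsLip.affine (-m) 1))
    · simpa [sub_eq_neg_add] using S.comp_mem hX ((IsLip.affine (-m) 1).max (IsLip.const 0))
    · have h6 := abs_le_smoothAbs ε (-m + X ω)
      have h7 := smoothAbs_pos hε (-m + X ω)
      refine max_le ?_ ?_
      · linarith
      · linarith [neg_abs_le (-m + X ω)]
  linarith

theorem IsAdditive.E_neg_abs_sub_nonneg (hA : S.IsAdditive X) (hX : X ∈ S.H)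
    (hU : S.UniformlyIntegrable X) {v : ℝ} (hv : -S.E (fun ω => -X ω) ≤ v) (hv' : v ≤ S.E X) :
    0 ≤ S.E (fun ω => -|X ω - v|) := by
  refine le_of_forall_pos_le_add fun δ hδ => ?_
  have hε : 0 < δ / 2 := by positivity
  set ε := δ / 2 with hεdef
  obtain ⟨n, t, l, ht, hnt, hn⟩ := hU.exists_step hε hε
  set U := S.E (fun ω => max (|X ω| - l) 0)
  have hg : IsLip (fun x => -smoothAbs ε x) := by
    simpa using (isLip_smoothAbs hε).const_mul (-1)
  have hstep : ∀ x, -smoothAbs ε (x + t * v) - (2 * t ^ 2 * l ^ 2 / ε + 4 * t * U)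
      ≤ S.E (fun ω => -smoothAbs ε (x + t * X ω)) := by
    intro x
    have h3 := smoothAbs_tangent_le hε x (t * v)
    have hr := fun y => smoothAbs_le_tangent_add hε ht l x y
    set c := x / smoothAbs ε x
    have hmul := S.comp_mem hX (IsLip.id.const_mul (-(c * t)))
    have hrem := S.comp_mem hX
      (isLip_remainder (smoothAbs ε x + 2 * t ^ 2 * l ^ 2 / ε) (4 * t) l)
    have hgx := S.comp_mem hX (hg.comp_isLip (IsLip.affine x t))
    -- Subadditivity bounds sums only from above, so the remainder is moved to the side of the test
    -- function, leaving the linear term alone.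
    have h1 := S.mono _ (S.H.add_mem hgx hrem) _ hmul fun ω => by
        have := hr (X ω)
        simp only [Pi.add_apply]
        linarith
    have h2 := S.subadd _ hgx _ hrem
    rw [E_remainder hX _ _ (by positivity)] at h2
    have h4 := h1.trans h2
    have h5 := mul_le_E_mul hX hv hv' (-(c * t))
    linarith
  have h := hA.le_iterate hX hg ht hstep n (-v)
  simp only [hnt, one_mul, neg_add_cancel, smoothAbs_zero hε] at h
  have h5 : S.E (fun ω => -smoothAbs ε (-v + X ω)) ≤ S.E (fun ω => -|X ω - v|) := by
    refine S.mono _ ?_ _ ?_ fun ω => ?_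
    · simpa [sub_eq_neg_add] using S.comp_mem hX ((IsLip.affine (-v) 1).abs.const_mul (-1))
    · simpa using S.comp_mem hX (hg.comp_isLip (IsLip.affine (-v) 1))
    · rw [sub_eq_neg_add]
      exact neg_le_neg (abs_le_smoothAbs ε _)
  linarith

theorem IsAdditive.maximallyDistributed (hA : S.IsAdditive X) (hX : X ∈ S.H)
    (hU : S.UniformlyIntegrable X) : S.MaximallyDistributed X := by
  set p := S.E X
  set q := S.E (fun ω => -X ω)
  have hXn : (fun ω => -X ω) ∈ S.H := S.H.neg_mem hX
  have hpq : -q ≤ p := by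
    have h := S.subadd _ hX _ hXn
    simp only [add_neg_cancel, S.const] at h
    linarith
  refine ⟨Set.Icc (-q) p, Metric.isBounded_Icc _ _, isClosed_Icc, convex_Icc _ _, fun φ hφ => ?_⟩
  obtain ⟨K, hK⟩ := id hφ
  obtain ⟨v, hv, hmax⟩ := isCompact_Icc.exists_isMaxOn (Set.nonempty_Icc.2 hpq)
    hK.continuous.continuousOn
  have hle : ∀ x y, φ x ≤ φ y + K * |x - y| := fun x y => by
    have h := hK.dist_le_mul x y
    rw [Real.dist_eq, Real.dist_eq] at h
    linarith [le_abs_self (φ x - φ y)]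
  have hlow : φ v ≤ S.E (fun ω => φ (X ω)) := by
    have hm : (fun ω => -|X ω - v|) ∈ S.H := by
      simpa [sub_eq_neg_add] using S.comp_mem hX ((IsLip.affine (-v) 1).abs.const_mul (-1))
    have hKm : (fun ω => K * -|X ω - v|) ∈ S.H := S.H.smul_mem (K : ℝ) hm
    have h1 := S.mono _ (S.comp_mem hX hφ) (fun ω => K * -|X ω - v| + φ v)
      (S.H.add_mem hKm (S.const_mem _)) fun ω => by
        have := hle v (X ω)
        rw [abs_sub_comm] at this
        linarith
    rw [S.E_add_const hKm, S.pos_homog _ hm _ K.coe_nonneg] at h1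
    have h2 := mul_nonneg K.coe_nonneg (hA.E_neg_abs_sub_nonneg hX hU hv.1 hv.2)
    exact (le_add_of_nonneg_left h2).trans h1
  have hup : S.E (fun ω => φ (X ω)) ≤ φ v := by
    have hm1 : (fun ω => max (X ω - p) 0) ∈ S.H := by
      simpa [sub_eq_neg_add] using S.comp_mem hX ((IsLip.affine (-p) 1).max (IsLip.const 0))
    have hm2 : (fun ω => max (-X ω - q) 0) ∈ S.H := by
      simpa [sub_eq_neg_add] using S.comp_mem hXn ((IsLip.affine (-q) 1).max (IsLip.const 0))
    have hm : (fun ω => max (X ω - p) 0 + max (-X ω - q) 0) ∈ S.H := S.H.add_mem hm1 hm2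
    have hKm : (fun ω => K * (max (X ω - p) 0 + max (-X ω - q) 0)) ∈ S.H :=
      S.H.smul_mem (K : ℝ) hm
    have h1 := S.mono (fun ω => K * (max (X ω - p) 0 + max (-X ω - q) 0) + φ v)
      (S.H.add_mem hKm (S.const_mem _)) _ (S.comp_mem hX hφ) fun ω => by
        rw [add_comm]
        -- `X ω` is compared with its projection onto `[-q, p]`; the two positive parts add up to
        -- the distance.
        refine (hle (X ω) (max (-q) (min (X ω) p))).trans (add_le_add ?_ ?_)
        · exact hmax ⟨le_max_left _ _, max_le hpq (min_le_right _ _)⟩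
        · refine mul_le_mul_of_nonneg_left ?_ K.coe_nonneg
          rcases le_total (X ω) p with h | h
          · rw [min_eq_left h]
            rcases le_total (-q) (X ω) with h' | h'
            · rw [max_eq_right h', sub_self, abs_zero]
              positivity
            · rw [max_eq_left h', abs_of_nonpos (by linarith)]
              linarith [le_max_left (-X ω - q) 0, le_max_right (X ω - p) 0]
          · rw [min_eq_right h, max_eq_right hpq, abs_of_nonneg (by linarith)]
            linarith [le_max_right (-X ω - q) 0, le_max_left (X ω - p) 0]
    rw [S.E_add_const hKm, S.pos_homog _ hm _ K.coe_nonneg] at h1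
    have h2 := S.subadd _ hm1 _ hm2
    have h3 := hA.E_pos_part_le_zero hX hU
    have h4 := hA.neg.E_pos_part_le_zero hXn hU.neg
    have h5 : S.E (fun ω => max (X ω - p) 0 + max (-X ω - q) 0) ≤ 0 := by linarith
    exact h1.trans (add_le_of_nonpos_left (mul_nonpos_of_nonneg_of_nonpos K.coe_nonneg h5))
  rw [le_antisymm hup hlow]
  refine ⟨⟨v, hv, rfl⟩, ?_⟩
  rintro _ ⟨x, hx, rfl⟩
  exact hmax hx

theorem MaximallyDistributed.isAdditive (h : S.MaximallyDistributed X) (hX : X ∈ S.H) :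
    S.IsAdditive X := by
  obtain ⟨Λ, -, -, hconv, hE⟩ := h
  intro φ hφ a b ha hb
  have h1 := hE (fun x => φ ((a + b) * x)) (hφ.comp_isLip (IsLip.id.const_mul (a + b)))
  have h2 := hE _ (S.isLip_inner_affine hX hφ a b)
  have h3 : ∀ x, IsGreatest ((fun y => φ (a * x + b * y)) '' Λ)
      (S.E (fun ω => φ (a * x + b * X ω))) :=
    fun x => hE (fun y => φ (a * x + b * y)) (hφ.comp_isLip (IsLip.affine (a * x) b))
  refine le_antisymm ?_ ?_
  · obtain ⟨x, hx, hxe⟩ := h1.1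
    rw [← hxe]
    refine le_trans ?_ (h2.2 ⟨x, hx, rfl⟩)
    exact (h3 x).2 ⟨x, hx, by simp only [add_mul]⟩
  · obtain ⟨x, hx, hxe⟩ := h2.1
    obtain ⟨y, hy, hye⟩ := (h3 x).1
    simp only at hxe hye
    rw [← hxe, ← hye]
    rcases (add_nonneg ha hb).eq_or_lt with h0 | h0
    · have ha0 : a = 0 := by linarith
      have hb0 : b = 0 := by linarith
      exact h1.2 ⟨x, hx, by simp [ha0, hb0]⟩
    -- The weighted mean lies in `Λ` by convexity, and `a + b` times it is `a * x + b * y`.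
    · refine h1.2 ⟨a / (a + b) * x + b / (a + b) * y, ?_, ?_⟩
      · exact hconv hx hy (by positivity) (by positivity) (by field_simp)
      · change φ _ = φ _
        congr 1
        field_simp

/-! ### Existence of an independent copy -/

/-- The space of Lipschitz functions of `X(ω₁)` and `X(ω₂)` on `Ω × Ω`, with the iterated
expectation. -/
def prodSelf (S : SublinearExpectationSpace Ω) (X : Ω → ℝ) (hX : X ∈ S.H) :
    SublinearExpectationSpace (Ω × Ω) where
  H :=
    -- For these functions the inner expectation is Lipschitz in `X ω`, hence in `S.H`, so the outer
    -- one obeys the axioms.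
    { carrier := {f | ∃ φ : ℝ × ℝ → ℝ, IsLip φ ∧ f = fun p => φ (X p.1, X p.2)}
      add_mem' := by
        rintro _ _ ⟨φ, hφ, rfl⟩ ⟨ψ, hψ, rfl⟩
        exact ⟨_, hφ.add hψ, rfl⟩
      zero_mem' := ⟨_, IsLip.const 0, rfl⟩
      smul_mem' := by
        rintro c _ ⟨φ, hφ, rfl⟩
        exact ⟨_, hφ.const_mul c, rfl⟩ }
  lip_comp_mem := by
    intro n f hf φ hφ
    choose ψ hψ hfψ using hf
    choose K hK using hψ
    refine ⟨fun p => φ (fun i => ψ i p), hφ.comp (f := fun p i => ψ i p) (K := ∑ i, K i) ?_, ?_⟩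
    · refine LipschitzWith.of_dist_le_mul fun x y => ?_
      refine (dist_pi_le_iff (by positivity)).2 fun i => ((hK i).dist_le_mul x y).trans ?_
      gcongr
      exact Finset.single_le_sum (f := K) (fun _ _ => zero_le) (Finset.mem_univ i)
    · simp only [hfψ]
  E f := S.E (fun ω => S.E (fun ω' => f (ω, ω')))
  mono := by
    rintro _ ⟨φ, hφ, rfl⟩ _ ⟨ψ, hψ, rfl⟩ h
    refine S.mono _ (S.inner_mem hX hX hφ) _ (S.inner_mem hX hX hψ) fun ω => ?_
    exact S.mono _ (S.comp₂_mem (S.const_mem (X ω)) hX hφ) _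
      (S.comp₂_mem (S.const_mem (X ω)) hX hψ) fun ω' => h (ω, ω')
  const c := by simp only [S.const]
  subadd := by
    rintro _ ⟨φ, hφ, rfl⟩ _ ⟨ψ, hψ, rfl⟩
    refine le_trans ?_ (S.subadd _ (S.inner_mem hX hX hφ) _ (S.inner_mem hX hX hψ))
    refine S.mono _ (S.H.add_mem (S.inner_mem hX hX hφ) (S.inner_mem hX hX hψ)) _
      (S.inner_mem hX hX (hφ.add hψ)) fun ω => ?_
    exact S.subadd _ (S.comp₂_mem (S.const_mem (X ω)) hX hφ) _
      (S.comp₂_mem (S.const_mem (X ω)) hX hψ)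
  pos_homog := by
    rintro _ ⟨φ, hφ, rfl⟩ l hl
    rw [← S.pos_homog _ (S.inner_mem hX hX hφ) l hl]
    congr 1
    funext ω
    exact S.pos_homog _ (S.comp₂_mem (S.const_mem (X ω)) hX hφ) l hl

theorem prodSelf_identDistrib (hX : X ∈ S.H) :
    (S.prodSelf X hX).IdentDistrib (fun p => X p.1) S X := by
  intro φ _
  simp only [prodSelf, S.const]

theorem prodSelf_isIndepCopy (hX : X ∈ S.H) :
    (S.prodSelf X hX).IsIndepCopy (fun p => X p.2) (fun p => X p.1) where
  mem := ⟨_, IsLip.snd, rfl⟩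
  indep := by
    intro φ _
    simp only [prodSelf, S.const]
  ident := by
    intro φ _
    simp only [prodSelf, S.const]

end SublinearExpectationSpace

theorem mainTheorem4 {Ω : Type*} (S : SublinearExpectationSpace Ω) (X : Ω → ℝ) (hX : X ∈ S.H)
    (hUI : S.UniformlyIntegrable X) :
    -- an independent copy of `X` exists, on a sublinear expectation space over `Ω × Ω`
    (∃ T : SublinearExpectationSpace (Ω × Ω), (fun p : Ω × Ω => X p.1) ∈ T.H ∧
      T.IdentDistrib (fun p => X p.1) S X ∧
      T.IsIndepCopy (fun p => X p.2) (fun p => X p.1)) ∧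
    -- the characterisation, on whatever space the pair is realised (`T = S`, `Y = X` included)
    (∀ {Ω' : Type*} (T : SublinearExpectationSpace Ω') (Y Ybar : Ω' → ℝ), Y ∈ T.H →
      T.IdentDistrib Y S X → T.IsIndepCopy Ybar Y →
      (S.MaximallyDistributed X ↔
        ∀ a b : ℝ, 0 ≤ a → 0 ≤ b →
          T.IdentDistrib (fun ω => a * Y ω + b * Ybar ω) S (fun ω => (a + b) * X ω))) := by
  refine ⟨⟨S.prodSelf X hX, ⟨_, IsLip.fst, rfl⟩, SublinearExpectationSpace.prodSelf_identDistrib hX,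
    SublinearExpectationSpace.prodSelf_isIndepCopy hX⟩, ?_⟩
  intro Ω' T Y Ybar _ hYX hc
  constructor
  · intro h a b ha hb φ hφ
    rw [hc.E_comp_add hX hYX hφ a b, h.isAdditive hX φ hφ a b ha hb]
  · intro h
    refine SublinearExpectationSpace.IsAdditive.maximallyDistributed ?_ hX hUI
    intro φ hφ a b ha hb
    rw [← hc.E_comp_add hX hYX hφ a b, h a b ha hb φ hφ]
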